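/- Throughout, $n\ge 0$ is an integer, $I_n=\{1,\dots,n\}$, and $\mathcal H,\widetilde{\mathcal H}$ are complex Hilbert spaces. A bounded operator $T$ on $\mathcal H$ is a near-isometry if there is $\delta>0$ with $\delta\|x\|\le\|Tx\|\le\|x\|$ for all $x\in\mathcal H$, and $T^{*m}T^{m+1}\mathcal H\subseteq T\mathcal H$ for every integer $m\ge 0$. Let $\{U_{ij}\}_{1\le i<j\le n}$ be commuting unitaries on $\mathcal H$ and put $U_{ji}:=U_{ij}^*$ for $i<j$. An $n$-tuple $T=(T_1,\dots,T_n)$ of near-isometries on $\mathcal H$ is a doubly twisted near-isometry with respect to $\{U_{ij}\}$ if, for all $i<j$ and all $k$, $$T_i^*T_j=U_{ij}^*T_jT_i^*,\qquad T_kU_{ij}=U_{ij}T_k,\qquad T_iT_j=U_{ij}T_jT_i .$$ An $n$-tuple of isometries is a doubly twisted isometry with respect to $\{U_{ij}\}$ if the first two of these relations hold. Tuples $T$ on $\mathcal H$ and $\widetilde T$ on $\widetilde{\mathcal H}$ are unitarily equivalent, $T\cong\widetilde T$, if there is a unitary $V:\mathcal H\to\widetilde{\mathcal H}$ with $VT_iV^*=\widetilde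 T_i$ for all $i$. For $A=\{a_1<\dots<a_m\}\subseteq I_n$ and $\boldsymbol k\in\mathbb N_0^{A}$ put $T_A^{\boldsymbol k}=T_{a_1}^{k_{a_1}}\cdots T_{a_m}^{k_{a_m}}$ (with $T_\emptyset^{\boldsymbol k}=I$), and let $$\mathcal D_A(T)=\bigcap_{\boldsymbol\ell\in\mathbb N_0^{I_n\setminus A}}T_{I_n\setminus A}^{\boldsymbol\ell}\Bigl(\bigcap_{i\in A}\ker T_i^*\Bigr)$$ be the $A$-wandering subspace of $T$, where the inner intersection is $\mathcal H$ if $A=\emptyset$. **Theorem.** Let $T$ on $\mathcal H$ and $\widetilde T$ on $\widetilde{\mathcal H}$ be doubly twisted near-isometries with respect to $\{U_{ij}\}$ and $\{\widetilde U_{ij}\}$, respectively. For every $A\subseteq I_n$, the operators $(T_A^{\boldsymbol k})^*T_A^{\boldsymbol k}$ ($\boldsymbol k\in\mathbb N_0^{A}$), $T_j$ ($j\in I_n\setminus A$) and $U_{ij}$ ($i\ne j$) map $\mathcal D_A(T)$ into itself. Moreover, $T\cong\widetilde T$ if and only if for each $A\subseteq I_n$ there exists a unitary $V_A:\mathcal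 D_A(T)\to\mathcal D_A(\widetilde T)$ such that on $\mathcal D_A(T)$ 1. $V_A(T_A^{\boldsymbol k})^*T_A^{\boldsymbol k}=(\widetilde T_A^{\boldsymbol k})^*\widetilde T_A^{\boldsymbol k}V_A$ for all $\boldsymbol k\in\mathbb N_0^{A}$; 2. $V_AT_j=\widetilde T_jV_A$ for all $j\in I_n\setminus A$; 3. $V_AU_{ij}=\widetilde U_{ij}V_A$ for all $1\le i\ne j\le n$. Finally, every doubly twisted isometry is a doubly twisted near-isometry with respect to the same unitaries, and two doubly twisted isometries $T$ and $\widetilde T$ satisfy $T\cong\widetilde T$ if and only if for each $A\subseteq I_n$ there is a unitary $V_A:\mathcal D_A(T)\to\mathcal D_A(\widetilde T)$ satisfying 2 and 3 (that is, their $A$-wandering data are equivalent for all $A$). -/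

import Mathlib

open ContinuousLinearMap (adjoint)

/-- A near-isometry: a contraction that is bounded below and satisfies
`T*ⁿ Tⁿ⁺¹ H ⊆ T H` for every `n ≥ 0`. -/
structure IsNearIsometry {H : Type*} [NormedAddCommGroup H] [InnerProductSpace ℂ H]
    [CompleteSpace H] (T : H →L[ℂ] H) : Prop where
  bounded_below : ∃ δ : ℝ, 0 < δ ∧ ∀ x, δ * ‖x‖ ≤ ‖T x‖
  contraction : ∀ x, ‖T x‖ ≤ ‖x‖
  range_condition : ∀ (n : ℕ) (x : H), ∃ y : H, (adjoint T ^ n) ((T ^ (n + 1)) x) = T y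

/-- `U` restricted to the indices `i < j` is a commuting family of unitaries, extended to the
indices `i > j` by `U j i = (U i j)*`. The diagonal entries `U i i` are irrelevant (they occur in
no hypothesis and in no conclusion). -/
structure IsTwistingFamily {H : Type*} [NormedAddCommGroup H] [InnerProductSpace ℂ H]
    [CompleteSpace H] {n : ℕ} (U : Fin n → Fin n → H →L[ℂ] H) : Prop where
  mem_unitary : ∀ i j, i < j → U i j ∈ unitary (H →L[ℂ] H)
  commute : ∀ i j p q, i < j → p < q → U i j * U p q = U p q * U i j
  swap : ∀ i j, i < j → U j i = adjoint (U i j)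

/-- `T = (T₁, …, Tₙ)` is a doubly twisted near-isometry with respect to `U`. -/
structure IsDoublyTwistedNearIsometry {H : Type*} [NormedAddCommGroup H] [InnerProductSpace ℂ H]
    [CompleteSpace H] {n : ℕ} (T : Fin n → H →L[ℂ] H) (U : Fin n → Fin n → H →L[ℂ] H) :
    Prop where
  twisting : IsTwistingFamily U
  nearIsometry : ∀ i, IsNearIsometry (T i)
  adjoint_mul : ∀ i j, i < j → adjoint (T i) * T j = adjoint (U i j) * T j * adjoint (T i)
  commute : ∀ i j k, i < j → T k * U i j = U i j * T k
  mul_comm_twist : ∀ i j, i < j → T i * T j = U i j * T j * T i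

/-- `T = (T₁, …, Tₙ)` is a doubly twisted isometry with respect to `U`. -/
structure IsDoublyTwistedIsometry {H : Type*} [NormedAddCommGroup H] [InnerProductSpace ℂ H]
    [CompleteSpace H] {n : ℕ} (T : Fin n → H →L[ℂ] H) (U : Fin n → Fin n → H →L[ℂ] H) :
    Prop where
  twisting : IsTwistingFamily U
  isometry : ∀ i, Isometry (T i)
  adjoint_mul : ∀ i j, i < j → adjoint (T i) * T j = adjoint (U i j) * T j * adjoint (T i)
  commute : ∀ i j k, i < j → T k * U i j = U i j * T k

/-- Unitary equivalence of tuples: a single unitary `V` with `V Tᵢ V* = Sᵢ` for all `i`. -/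
def TupleUnitarilyEquivalent {H K : Type*} [NormedAddCommGroup H] [InnerProductSpace ℂ H]
    [NormedAddCommGroup K] [InnerProductSpace ℂ K] {n : ℕ}
    (T : Fin n → H →L[ℂ] H) (S : Fin n → K →L[ℂ] K) : Prop :=
  ∃ V : H ≃ₗᵢ[ℂ] K, ∀ (i : Fin n) (y : K), V (T i (V.symm y)) = S i y

/-- `T_A^k = T_{a₁}^{k_{a₁}} ⋯ T_{aₘ}^{k_{aₘ}}` for `A = {a₁ < ⋯ < aₘ}`. The exponents are indexed
by all of `Fin n`; only those with index in `A` matter. -/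
def tuplePow {H : Type*} [NormedAddCommGroup H] [InnerProductSpace ℂ H] {n : ℕ}
    (T : Fin n → H →L[ℂ] H) (A : Finset (Fin n)) (k : Fin n → ℕ) : H →L[ℂ] H :=
  (((List.finRange n).filter (fun a => a ∈ A)).map (fun a => T a ^ k a)).prod

/-- `W_A = ⋂_{i ∈ A} ker Tᵢ*`; in particular `W_∅` is the whole space. -/
noncomputable def kerSubspace {H : Type*} [NormedAddCommGroup H] [InnerProductSpace ℂ H] [CompleteSpace H]
    {n : ℕ} (T : Fin n → H →L[ℂ] H) (A : Finset (Fin n)) : Submodule ℂ H :=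
  ⨅ i ∈ A, LinearMap.ker (adjoint (T i) : H →ₗ[ℂ] H)

/-- The `A`-wandering subspace `D_A(T) = ⋂_ℓ T_{Aᶜ}^ℓ W_A`. -/
noncomputable def wanderingSubspace {H : Type*} [NormedAddCommGroup H] [InnerProductSpace ℂ H]
    [CompleteSpace H] {n : ℕ} (T : Fin n → H →L[ℂ] H) (A : Finset (Fin n)) : Submodule ℂ H :=
  ⨅ l : Fin n → ℕ, (kerSubspace T A).map (tuplePow T Aᶜ l : H →ₗ[ℂ] H)

/-- `V X = Y V` on `D`, where `V` is defined only on `D`: for `x ∈ D` the vector `X x` lies in `D`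
(so that `V` can be applied to it) and `V (X x) = Y (V x)`. -/
def IntertwinesOn {H K : Type*} [NormedAddCommGroup H] [InnerProductSpace ℂ H]
    [NormedAddCommGroup K] [InnerProductSpace ℂ K] {D : Submodule ℂ H} {E : Submodule ℂ K}
    (V : D ≃ₗᵢ[ℂ] E) (X : H →L[ℂ] H) (Y : K →L[ℂ] K) : Prop :=
  ∀ x : D, ∃ hx : X x ∈ D, (V ⟨X x, hx⟩ : K) = Y (V x)

/-- Equivalence of the `A`-wandering data of `(T, U)` and `(T', U')`. -/
def WanderingDataEquivalent {H K : Type*} [NormedAddCommGroup H] [InnerProductSpace ℂ H]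
    [CompleteSpace H] [NormedAddCommGroup K] [InnerProductSpace ℂ K] [CompleteSpace K] {n : ℕ}
    (T : Fin n → H →L[ℂ] H) (U : Fin n → Fin n → H →L[ℂ] H)
    (T' : Fin n → K →L[ℂ] K) (U' : Fin n → Fin n → K →L[ℂ] K) (A : Finset (Fin n)) : Prop :=
  ∃ V : wanderingSubspace T A ≃ₗᵢ[ℂ] wanderingSubspace T' A,
    (∀ j, j ∉ A → IntertwinesOn V (T j) (T' j)) ∧
    (∀ i j, i ≠ j → IntertwinesOn V (U i j) (U' i j))

/-! A single near-isometry `T` has a Wold decomposition: H is the orthogonal sum of the subspaces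
`T^k (ker T*)` and of the intersection of the ranges of all powers. Boundedness below makes these
subspaces closed, and the range condition makes them orthogonal (`inner_pow_pow_succ`).

For a doubly twisted tuple, every `T j` with `j ≠ i` reduces each Wold summand of `T i`
(`reduces_of_ne`), so the projections onto these summands respect the summands of the other
operators. Hence the joint summands, indexed by one element of `Option ℕ` per coordinate, span a
dense subspace (`eq_zero_of_inner_of_mem`). Let `A` be the set of coordinates with a finite index
and `k` the tuple of these indices; the joint summand is then `T_A^k D_A(T)`. So the vectors `T_A^k
x` with `x ∈ D_A(T)` are total, and those with different `(A, k)` are orthogonal.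

Given the unitaries `V_A`, send `T_A^k x` to `T'_A^k (V_A x)`. Condition 1 says exactly that the two
families have the same Gram matrix, so this extends to a unitary. It intertwines the tuples because
`T i` carries `T_A^k x` to some `T_A^l y`, where `y` arises from `x` by a word in the `U`'s and
possibly `T i`, and conditions 2 and 3 provide the same formula on the other side. Conversely, a
unitary equivalence restricts to the wandering subspaces, and it intertwines the `U`'s because the
tuple determines them. For isometries the Gram operators in condition 1 are identities. -/

/-! ### Wold decomposition of one near-isometry. -/

section Wold

variable {H : Type*} [NormedAddCommGroup H] [InnerProductSpace ℂ H] [CompleteSpace H]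

/-- The summands of the Wold decomposition of `T`: the subspace `Tᵏ (ker T*)` for a natural
number `k`, and the intersection of the ranges of all powers of `T`. -/
noncomputable def woldSubspace (T : H →L[ℂ] H) : Option ℕ → Submodule ℂ H
  | some k => (LinearMap.ker (adjoint T : H →ₗ[ℂ] H)).map (T ^ k : H →L[ℂ] H).toLinearMap
  | none => ⨅ m : ℕ, LinearMap.range (T ^ m : H →L[ℂ] H).toLinearMap

theorem mem_woldSubspace_some {T : H →L[ℂ] H} {k : ℕ} {x : H} :
    x ∈ woldSubspace T (some k) ↔ ∃ w, adjoint T w = 0 ∧ (T ^ k) w = x := by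
  simp only [woldSubspace, Submodule.mem_map]
  rfl

theorem mem_woldSubspace_none {T : H →L[ℂ] H} {x : H} :
    x ∈ woldSubspace T none ↔ ∀ m : ℕ, ∃ y, (T ^ m) y = x := by
  simp only [woldSubspace, Submodule.mem_iInf, LinearMap.mem_range]
  rfl

theorem mem_woldSubspace_zero {T : H →L[ℂ] H} {x : H} :
    x ∈ woldSubspace T (some 0) ↔ adjoint T x = 0 := by
  simp [mem_woldSubspace_some]

theorem IsNearIsometry.injective {T : H →L[ℂ] H} (hT : IsNearIsometry T) :
    Function.Injective T := by
  obtain ⟨δ, hδ, h⟩ := hT.bounded_below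
  refine (injective_iff_map_eq_zero T).2 fun x hx => ?_
  have := h x
  rw [hx, norm_zero] at this
  exact norm_le_zero_iff.1 (nonpos_of_mul_nonpos_right this hδ)

theorem IsNearIsometry.injective_pow {T : H →L[ℂ] H} (hT : IsNearIsometry T) (k : ℕ) :
    Function.Injective (T ^ k : H →L[ℂ] H) := by
  induction k with
  | zero => simpa using Function.injective_id
  | succ k ih => rw [pow_succ]; exact ih.comp hT.injective

theorem IsNearIsometry.isClosedEmbedding {T : H →L[ℂ] H} (hT : IsNearIsometry T) :
    Topology.IsClosedEmbedding T := by
  obtain ⟨δ, hδ, h⟩ := hT.bounded_below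
  have : AntilipschitzWith (Real.toNNReal δ⁻¹) T := by
    refine T.antilipschitz_of_bound fun x => ?_
    rw [Real.coe_toNNReal _ (inv_nonneg.2 hδ.le), inv_mul_eq_div, le_div_iff₀ hδ, mul_comm]
    exact h x
  exact this.isClosedEmbedding T.uniformContinuous

theorem IsNearIsometry.isClosedEmbedding_pow {T : H →L[ℂ] H} (hT : IsNearIsometry T) (k : ℕ) :
    Topology.IsClosedEmbedding (T ^ k : H →L[ℂ] H) := by
  induction k with
  | zero => simpa using Topology.IsClosedEmbedding.id
  | succ k ih => rw [pow_succ]; exact ih.comp hT.isClosedEmbedding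

theorem IsNearIsometry.isClosed_woldSubspace {T : H →L[ℂ] H} (hT : IsNearIsometry T)
    (c : Option ℕ) : IsClosed (woldSubspace T c : Set H) := by
  cases c with
  | some k =>
    simp only [woldSubspace, Submodule.map_coe]
    exact (hT.isClosedEmbedding_pow k).isClosedMap _ (adjoint T).isClosed_ker
  | none =>
    simp only [woldSubspace, Submodule.coe_iInf]
    refine isClosed_iInter fun m => ?_
    exact (hT.isClosedEmbedding_pow m).isClosed_range

theorem IsNearIsometry.hasOrthogonalProjection {T : H →L[ℂ] H} (hT : IsNearIsometry T)
    (c : Option ℕ) : (woldSubspace T c).HasOrthogonalProjection := by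
  have := (hT.isClosed_woldSubspace c).completeSpace_coe
  infer_instance

/-- The range condition enters here: moving `T^k` across the inner product leaves `T*^k T^(k+1) y`,
which lies in the range of `T` and so is orthogonal to `w`. -/
theorem IsNearIsometry.inner_pow_pow_succ {T : H →L[ℂ] H} (hT : IsNearIsometry T) {w : H}
    (hw : adjoint T w = 0) (k : ℕ) (y : H) :
    inner ℂ ((T ^ k) w) ((T ^ (k + 1)) y) = 0 := by
  obtain ⟨z, hz⟩ := hT.range_condition k y
  rw [← ContinuousLinearMap.adjoint_inner_right]
  have : adjoint (T ^ k) = adjoint T ^ k := by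
    simp only [← ContinuousLinearMap.star_eq_adjoint, star_pow]
  rw [this, hz, ← ContinuousLinearMap.adjoint_inner_left, hw, inner_zero_left]

theorem IsNearIsometry.inner_pow_pow {T : H →L[ℂ] H} (hT : IsNearIsometry T) {w : H}
    (hw : adjoint T w = 0) {k l : ℕ} (h : k < l) (y : H) :
    inner ℂ ((T ^ k) w) ((T ^ l) y) = 0 := by
  obtain ⟨m, rfl⟩ := Nat.exists_eq_add_of_lt h
  rw [show k + m + 1 = (k + 1) + m by ring, pow_add T (k + 1) m]
  exact hT.inner_pow_pow_succ hw k _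

theorem IsNearIsometry.inner_woldSubspace {T : H →L[ℂ] H} (hT : IsNearIsometry T)
    {c d : Option ℕ} (h : c ≠ d) {x y : H} (hx : x ∈ woldSubspace T c)
    (hy : y ∈ woldSubspace T d) : inner ℂ x y = 0 := by
  have key : ∀ {k : ℕ} {x y : H}, x ∈ woldSubspace T (some k) → y ∈ woldSubspace T none →
      inner ℂ x y = 0 := by
    intro k x y hx hy
    obtain ⟨w, hw, rfl⟩ := mem_woldSubspace_some.1 hx
    obtain ⟨z, rfl⟩ := mem_woldSubspace_none.1 hy (k + 1)
    exact hT.inner_pow_pow_succ hw k z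
  match c, d, h, hx, hy with
  | none, none, h, _, _ => exact absurd rfl h
  | some k, none, _, hx, hy => exact key hx hy
  | none, some k, _, hx, hy => exact inner_eq_zero_symm.1 (key hy hx)
  | some k, some l, h, hx, hy =>
    obtain ⟨v, hv, rfl⟩ := mem_woldSubspace_some.1 hx
    obtain ⟨w, hw, rfl⟩ := mem_woldSubspace_some.1 hy
    rcases lt_or_gt_of_ne (fun e : k = l => h (congrArg some e)) with h | h
    · exact hT.inner_pow_pow hv h w
    · exact inner_eq_zero_symm.1 (hT.inner_pow_pow hw h v)

/-- Since `T^k w` is orthogonal to `T^(k+1) H`, the vector `T*^k T^k w` is orthogonal to `T H`. This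
is the source of the invariance of the wandering subspaces under the Gram operators. -/
theorem IsNearIsometry.adjoint_pow_apply_mem {T : H →L[ℂ] H} (hT : IsNearIsometry T) {k : ℕ}
    {x : H} (hx : x ∈ woldSubspace T (some k)) :
    adjoint (T ^ k) x ∈ woldSubspace T (some 0) := by
  obtain ⟨w, hw, rfl⟩ := mem_woldSubspace_some.1 hx
  refine mem_woldSubspace_zero.2 (ext_inner_right ℂ fun y => ?_)
  rw [inner_zero_left, ContinuousLinearMap.adjoint_inner_left,
    ContinuousLinearMap.adjoint_inner_left]
  have := hT.inner_pow_pow_succ hw k y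
  rwa [pow_succ] at this

theorem IsNearIsometry.exists_add {T : H →L[ℂ] H} (hT : IsNearIsometry T) (x : H) :
    ∃ w y, adjoint T w = 0 ∧ x = w + T y := by
  have hc : IsClosed (LinearMap.range (T : H →ₗ[ℂ] H) : Set H) :=
    hT.isClosedEmbedding.isClosed_range
  have := hc.completeSpace_coe
  obtain ⟨y, ⟨u, rfl⟩, z, hz, rfl⟩ :=
    (LinearMap.range (T : H →ₗ[ℂ] H)).exists_add_mem_mem_orthogonal x
  refine ⟨z, u, ?_, add_comm _ _⟩
  rw [ContinuousLinearMap.orthogonal_range] at hz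
  exact hz

/-- Induction on the power: if `x = T^m y` and `y = w + T z` with `w ∈ ker T*`, then `T^m w` is
orthogonal to `x` and to `T^(m+1) z`, hence to itself, and `x = T^(m+1) z`. -/
theorem IsNearIsometry.mem_woldSubspace_none_of_inner {T : H →L[ℂ] H} (hT : IsNearIsometry T)
    {x : H} (h : ∀ k w, adjoint T w = 0 → inner ℂ ((T ^ k) w) x = 0) :
    x ∈ woldSubspace T none := by
  refine mem_woldSubspace_none.2 fun m => ?_
  induction m with
  | zero => exact ⟨x, by simp⟩
  | succ m ih =>
    obtain ⟨y, rfl⟩ := ih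
    obtain ⟨w, z, hw, rfl⟩ := hT.exists_add y
    have h1 := h m w hw
    have h2 := hT.inner_pow_pow_succ hw m z
    rw [pow_succ] at h2
    rw [map_add, inner_add_right, show inner ℂ ((T ^ m) w) ((T ^ m) (T z)) = 0 from h2, add_zero,
      inner_self_eq_zero] at h1
    exact ⟨z, by rw [map_add, h1, zero_add, pow_succ]; rfl⟩

theorem IsNearIsometry.eq_zero_of_inner_woldSubspace {T : H →L[ℂ] H} (hT : IsNearIsometry T)
    {x : H} (h : ∀ c, ∀ y ∈ woldSubspace T c, inner ℂ y x = 0) : x = 0 := by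
  have hx : x ∈ woldSubspace T none := hT.mem_woldSubspace_none_of_inner fun k w hw =>
    h (some k) _ (mem_woldSubspace_some.2 ⟨w, hw, rfl⟩)
  exact inner_self_eq_zero.1 (h none x hx)

theorem IsNearIsometry.exists_mem_woldSubspace_none {T : H →L[ℂ] H} (hT : IsNearIsometry T)
    {x : H} (hx : x ∈ woldSubspace T none) (k : ℕ) :
    ∃ y ∈ woldSubspace T none, (T ^ k) y = x := by
  rw [mem_woldSubspace_none] at hx
  obtain ⟨y, rfl⟩ := hx k
  refine ⟨y, mem_woldSubspace_none.2 fun m => ?_, rfl⟩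
  obtain ⟨z, hz⟩ := hx (k + m)
  exact ⟨z, hT.injective_pow k (by rw [← hz, pow_add]; rfl)⟩

/-! ### Reducing subspaces. -/

/-- A subspace `M` reduces the operator `S`: it is invariant under `S` and its adjoint. -/
def Reduces (M : Submodule ℂ H) (S : H →L[ℂ] H) : Prop :=
  (∀ x ∈ M, S x ∈ M) ∧ ∀ x ∈ M, adjoint S x ∈ M

theorem Reduces.one (M : Submodule ℂ H) : Reduces M 1 := by
  refine ⟨fun x hx => hx, fun x hx => ?_⟩
  rwa [← ContinuousLinearMap.star_eq_adjoint, star_one]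

theorem Reduces.mul {M : Submodule ℂ H} {R S : H →L[ℂ] H} (hR : Reduces M R) (hS : Reduces M S) :
    Reduces M (R * S) := by
  refine ⟨fun x hx => hR.1 _ (hS.1 x hx), fun x hx => ?_⟩
  rw [← ContinuousLinearMap.star_eq_adjoint, star_mul]
  exact hS.2 _ (hR.2 x hx)

theorem Reduces.pow {M : Submodule ℂ H} {S : H →L[ℂ] H} (hS : Reduces M S) (k : ℕ) :
    Reduces M (S ^ k) := by
  induction k with
  | zero => exact Reduces.one M
  | succ k ih => rw [pow_succ]; exact ih.mul hS

theorem Reduces.adjoint {M : Submodule ℂ H} {S : H →L[ℂ] H} (hS : Reduces M S) :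
    Reduces M (adjoint S) :=
  ⟨hS.2, by simpa using hS.1⟩

theorem Reduces.list_prod {M : Submodule ℂ H} {L : List (H →L[ℂ] H)} (h : ∀ S ∈ L, Reduces M S) :
    Reduces M L.prod := by
  induction L with
  | nil => exact Reduces.one M
  | cons S L ih =>
    rw [List.prod_cons]
    exact (h S (by simp)).mul (ih fun R hR => h R (by simp [hR]))

theorem Reduces.commute_starProjection {M : Submodule ℂ H} [M.HasOrthogonalProjection]
    {S : H →L[ℂ] H} (hS : Reduces M S) : Commute M.starProjection S := by
  ext x
  obtain ⟨y, hy, z, hz, rfl⟩ := M.exists_add_mem_mem_orthogonal x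
  have hSz : S z ∈ Mᗮ := by
    intro m hm
    rw [← ContinuousLinearMap.adjoint_inner_left]
    exact hz _ (hS.2 m hm)
  simp [Submodule.starProjection_eq_self_iff.2 hy,
    Submodule.starProjection_eq_self_iff.2 (hS.1 y hy),
    (Submodule.starProjection_apply_eq_zero_iff M).2 hz,
    (Submodule.starProjection_apply_eq_zero_iff M).2 hSz]

/-- With `P` the projection onto `M`, `S P x = P S x = S x`, so `P x = x` by injectivity. This
allows division by powers of `T j` inside a Wold summand of `T i`. -/
theorem Reduces.mem_of_apply_mem {M : Submodule ℂ H} [M.HasOrthogonalProjection]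
    {S : H →L[ℂ] H} (hS : Reduces M S) (hinj : Function.Injective S) {x : H} (hx : S x ∈ M) :
    x ∈ M := by
  rw [← Submodule.starProjection_eq_self_iff] at hx ⊢
  apply hinj
  have := DFunLike.congr_fun hS.commute_starProjection.eq x
  exact this.symm.trans hx

/-- An operator that commutes with `T` and `T*` up to twists leaves the Wold summands of `T`
invariant. -/
theorem apply_mem_woldSubspace {T S u v : H →L[ℂ] H} (h : S * T = u * (T * S))
    (hT : Commute T u) (hT' : Commute (adjoint T) u) (h' : adjoint T * S = v * adjoint T)
    (c : Option ℕ) {x : H} (hx : x ∈ woldSubspace T c) : S x ∈ woldSubspace T c := by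
  have hpow : ∀ k : ℕ, S * T ^ k = T ^ k * (u ^ k * S) := by
    intro k
    induction k with
    | zero => simp
    | succ k ih =>
      calc S * T ^ (k + 1) = T ^ k * (u ^ k * u) * (T * S) := by
            rw [pow_succ, ← mul_assoc, ih, mul_assoc, mul_assoc, h]; simp only [mul_assoc]
        _ = T ^ k * (T * u ^ (k + 1)) * S := by
            rw [← pow_succ, (hT.pow_right (k + 1)).eq]; simp only [mul_assoc]
        _ = T ^ (k + 1) * (u ^ (k + 1) * S) := by rw [pow_succ T]; simp only [mul_assoc]
  cases c with
  | none =>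
    rw [mem_woldSubspace_none] at hx ⊢
    intro m
    obtain ⟨y, rfl⟩ := hx m
    exact ⟨_, (DFunLike.congr_fun (hpow m) y).symm⟩
  | some k =>
    obtain ⟨w, hw, rfl⟩ := mem_woldSubspace_some.1 hx
    refine mem_woldSubspace_some.2 ⟨(u ^ k * S) w, ?_, (DFunLike.congr_fun (hpow k) w).symm⟩
    -- The accumulated twist `u ^ k` is absorbed into the kernel vector, which stays in `ker T*`
    -- because `T*` can be moved to the far right.
    have e : adjoint T * (u ^ k * S) = u ^ k * v * adjoint T := by
      rw [← mul_assoc, (hT'.pow_right k).eq, mul_assoc, h', mul_assoc]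
    have := DFunLike.congr_fun e w
    simp only [mul_assoc] at this
    refine this.trans ?_
    change (u ^ k) (v (adjoint T w)) = 0
    rw [hw, map_zero, map_zero]

theorem apply_mem_woldSubspace_of_commute {T S : H →L[ℂ] H} (h : Commute S T)
    (h' : Commute S (adjoint T)) (c : Option ℕ) {x : H} (hx : x ∈ woldSubspace T c) :
    S x ∈ woldSubspace T c :=
  apply_mem_woldSubspace (u := 1) (v := S) (by rw [one_mul]; exact h.eq) (Commute.one_right _)
    (Commute.one_right _) h'.eq.symm c hx

theorem IsNearIsometry.reduces_woldSubspace_none {T : H →L[ℂ] H} (hT : IsNearIsometry T) :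
    Reduces (woldSubspace T none) T := by
  constructor
  · intro x hx
    rw [mem_woldSubspace_none] at hx ⊢
    intro m
    obtain ⟨y, rfl⟩ := hx m
    exact ⟨T y, by
      rw [← mul_apply_eq_comp, ← mul_apply_eq_comp, ← pow_succ,
        ← pow_succ']⟩
  · intro x hx
    refine hT.mem_woldSubspace_none_of_inner fun k w hw => ?_
    rw [ContinuousLinearMap.adjoint_inner_right]
    refine hT.inner_woldSubspace (c := some (k + 1)) (d := none) (by simp) ?_ hx
    exact mem_woldSubspace_some.2 ⟨w, hw, by rw [pow_succ']; rfl⟩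

end Wold

/-! ### Unitaries from Gram matrices and their restrictions. -/

section Extension

variable {H K : Type*} [NormedAddCommGroup H] [InnerProductSpace ℂ H] [CompleteSpace H]
  [NormedAddCommGroup K] [InnerProductSpace ℂ K] [CompleteSpace K]

theorem denseRange_linearCombination {ι : Type*} {p : ι → H}
    (hp : ∀ x, (∀ i, inner ℂ (p i) x = 0) → x = 0) :
    DenseRange (Finsupp.linearCombination ℂ p) := by
  have h : (LinearMap.range (Finsupp.linearCombination ℂ p)).topologicalClosure = ⊤ := by
    rw [Submodule.topologicalClosure_eq_top_iff, Submodule.eq_bot_iff]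
    intro x hx
    refine hp x fun i => hx _ ⟨Finsupp.single i 1, by simp⟩
  exact (Submodule.dense_iff_topologicalClosure_eq_top.2 h :)

/-- Two total families with the same Gram matrix are related by a unitary. -/
theorem exists_linearIsometryEquiv_of_inner_eq {ι : Type*} {p : ι → H} {q : ι → K}
    (h : ∀ i j, inner ℂ (p i) (p j) = inner ℂ (q i) (q j))
    (hp : ∀ x, (∀ i, inner ℂ (p i) x = 0) → x = 0)
    (hq : ∀ x, (∀ i, inner ℂ (q i) x = 0) → x = 0) :
    ∃ V : H ≃ₗᵢ[ℂ] K, ∀ i, V (p i) = q i := by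
  have hn : ∀ f : ι →₀ ℂ, ‖Finsupp.linearCombination ℂ q (LinearEquiv.refl ℂ _ f)‖ =
      ‖Finsupp.linearCombination ℂ p f‖ := by
    intro f
    rw [LinearEquiv.refl_apply, @norm_eq_sqrt_re_inner ℂ, @norm_eq_sqrt_re_inner ℂ]
    simp only [Finsupp.linearCombination_apply, Finsupp.sum_inner, Finsupp.inner_sum,
      inner_smul_left, inner_smul_right, h]
  -- Both spaces receive the finitely supported coefficient vectors with dense range, and equal Gram
  -- matrices give equal norms; the identity on coefficients extends by density.
  refine ⟨(LinearEquiv.refl ℂ (ι →₀ ℂ)).extendOfIsometry (Finsupp.linearCombination ℂ p)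
    (Finsupp.linearCombination ℂ q) (denseRange_linearCombination hp)
    (denseRange_linearCombination hq) hn, fun i => ?_⟩
  have := LinearEquiv.extendOfIsometry_eq (LinearEquiv.refl ℂ (ι →₀ ℂ))
    (Finsupp.linearCombination ℂ p) (Finsupp.linearCombination ℂ q)
    (denseRange_linearCombination hp) (denseRange_linearCombination hq) hn (Finsupp.single i 1)
  simpa using this

theorem LinearIsometryEquiv.exists_restrict {H K : Type*} [NormedAddCommGroup H]
    [InnerProductSpace ℂ H] [NormedAddCommGroup K] [InnerProductSpace ℂ K] (V : H ≃ₗᵢ[ℂ] K)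
    {D : Submodule ℂ H} {E : Submodule ℂ K} (h : ∀ x, x ∈ D ↔ V x ∈ E) :
    ∃ W : D ≃ₗᵢ[ℂ] E, ∀ x : D, (W x : K) = V x := by
  refine ⟨⟨V.toLinearEquiv.ofSubmodules D E ?_, fun x => V.norm_map x⟩, fun x => rfl⟩
  ext y
  simp only [Submodule.mem_map]
  constructor
  · rintro ⟨x, hx, rfl⟩
    exact (h x).1 hx
  · intro hy
    exact ⟨V.symm y, (h _).2 (by simpa using hy), by simp⟩

end Extension

/-! ### Reordering products up to twists that commute with all factors. -/

section ListPow

variable {ι M : Type*} [Monoid M]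

/-- The ordered product of the powers `t a ^ k a` for `a` in the list `L`. -/
def listPow (t : ι → M) (L : List ι) (k : ι → ℕ) : M :=
  (L.map fun a => t a ^ k a).prod

@[simp]
theorem listPow_nil (t : ι → M) (k : ι → ℕ) : listPow t [] k = 1 := rfl

@[simp]
theorem listPow_cons (t : ι → M) (a : ι) (L : List ι) (k : ι → ℕ) :
    listPow t (a :: L) k = t a ^ k a * listPow t L k := by
  simp [listPow]

theorem listPow_congr (t : ι → M) {L : List ι} {k l : ι → ℕ} (h : ∀ a ∈ L, k a = l a) :
    listPow t L k = listPow t L l := by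
  unfold listPow
  congr 1
  exact List.map_congr_left fun a ha => by rw [h a ha]

theorem map_listPow {N : Type*} [Monoid N] (f : M →* N) (t : ι → M) (L : List ι) (k : ι → ℕ) :
    f (listPow t L k) = listPow (fun i => f (t i)) L k := by
  simp [listPow, map_list_prod, Function.comp_def]

variable {t : ι → M} {C : Submonoid M} (hC : ∀ c ∈ C, ∀ i, Commute c (t i))
  (ht : ∀ i j, i ≠ j → ∃ c ∈ C, t i * t j = c * (t j * t i))

include hC ht

theorem exists_mul_pow_eq {i j : ι} (hij : i ≠ j) (b : ℕ) :
    ∃ c ∈ C, t i * t j ^ b = c * (t j ^ b * t i) := by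
  induction b with
  | zero => exact ⟨1, C.one_mem, by simp⟩
  | succ b ih =>
    obtain ⟨c, hc, e⟩ := ih
    obtain ⟨d, hd, e'⟩ := ht i j hij
    refine ⟨c * d, C.mul_mem hc hd, ?_⟩
    calc t i * t j ^ (b + 1) = c * (t j ^ b * (t i * t j)) := by
          rw [pow_succ, ← mul_assoc, e]; simp only [mul_assoc]
      _ = c * (d * t j ^ b * (t j * t i)) := by
          rw [e', ((hC d hd j).pow_right b).eq]; simp only [mul_assoc]
      _ = c * d * (t j ^ (b + 1) * t i) := by rw [pow_succ]; simp only [mul_assoc]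

theorem exists_pow_mul_pow_eq {i j : ι} (hij : i ≠ j) (a b : ℕ) :
    ∃ c ∈ C, t i ^ a * t j ^ b = c * (t j ^ b * t i ^ a) := by
  induction a with
  | zero => exact ⟨1, C.one_mem, by simp⟩
  | succ a ih =>
    obtain ⟨c, hc, e⟩ := ih
    obtain ⟨d, hd, e'⟩ := exists_mul_pow_eq hC ht hij b
    refine ⟨d * c, C.mul_mem hd hc, ?_⟩
    calc t i ^ (a + 1) * t j ^ b = t i ^ a * (t i * t j ^ b) := by rw [pow_succ, mul_assoc]
      _ = t i ^ a * d * (t j ^ b * t i) := by rw [e']; simp only [mul_assoc]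
      _ = d * (t i ^ a * t j ^ b) * t i := by
          rw [← ((hC d hd i).pow_right a).eq]; simp only [mul_assoc]
      _ = d * c * (t j ^ b * t i ^ (a + 1)) := by rw [e, pow_succ]; simp only [mul_assoc]

theorem exists_mul_listPow_of_notMem {i : ι} {L : List ι} (hi : i ∉ L) (k : ι → ℕ) :
    ∃ c ∈ C, t i * listPow t L k = c * (listPow t L k * t i) := by
  induction L with
  | nil => exact ⟨1, C.one_mem, by simp⟩
  | cons a L ih =>
    rw [List.mem_cons, not_or] at hi
    obtain ⟨c, hc, e⟩ := ih hi.2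
    obtain ⟨d, hd, e'⟩ := exists_mul_pow_eq hC ht hi.1 (k a)
    refine ⟨d * c, C.mul_mem hd hc, ?_⟩
    calc t i * listPow t (a :: L) k = d * (t a ^ k a * (t i * listPow t L k)) := by
          rw [listPow_cons, ← mul_assoc, e']; simp only [mul_assoc]
      _ = d * (c * t a ^ k a) * (listPow t L k * t i) := by
          rw [e, ((hC c hc a).pow_right (k a)).eq]; simp only [mul_assoc]
      _ = d * c * (listPow t (a :: L) k * t i) := by rw [listPow_cons]; simp only [mul_assoc]

/-- Pulls the factor of index `i` to the front. Setting its exponent to 0 leaves a factor 1 in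
place, so the list itself need not change. -/
theorem exists_listPow_eq [DecidableEq ι] {i : ι} {L : List ι} (hL : L.Nodup) (hi : i ∈ L)
    (k : ι → ℕ) :
    ∃ c ∈ C, listPow t L k = c * (t i ^ k i * listPow t L (Function.update k i 0)) := by
  induction L with
  | nil => simp at hi
  | cons a L ih =>
    rw [List.nodup_cons] at hL
    by_cases h : i = a
    · subst h
      refine ⟨1, C.one_mem, ?_⟩
      rw [listPow_cons, listPow_cons, Function.update_self, pow_zero, one_mul, one_mul]
      congr 1
      exact listPow_congr t fun b hb => by rw [Function.update_of_ne (by rintro rfl; exact hL.1 hb)]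
    · obtain ⟨c, hc, e⟩ := ih hL.2 (by simpa [h] using hi)
      obtain ⟨d, hd, e'⟩ := exists_pow_mul_pow_eq hC ht (Ne.symm h) (k a) (k i)
      refine ⟨c * d, C.mul_mem hc hd, ?_⟩
      calc listPow t (a :: L) k
          = t a ^ k a * c * (t i ^ k i * listPow t L (Function.update k i 0)) := by
            rw [listPow_cons, e]; simp only [mul_assoc]
        _ = c * (t a ^ k a * t i ^ k i) * listPow t L (Function.update k i 0) := by
            rw [← ((hC c hc a).pow_right (k a)).eq]; simp only [mul_assoc]
        _ = c * d * (t i ^ k i * listPow t (a :: L) (Function.update k i 0)) := by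
            rw [e', listPow_cons, Function.update_of_ne (Ne.symm h)]; simp only [mul_assoc]

/-- Proved separately from `exists_listPow_eq`, since elements of `C` are not assumed invertible. -/
theorem exists_pow_mul_listPow_eq [DecidableEq ι] {i : ι} {L : List ι} (hL : L.Nodup) (hi : i ∈ L)
    (k : ι → ℕ) :
    ∃ c ∈ C, t i ^ k i * listPow t L (Function.update k i 0) = c * listPow t L k := by
  induction L with
  | nil => simp at hi
  | cons a L ih =>
    rw [List.nodup_cons] at hL
    by_cases h : i = a
    · subst h
      refine ⟨1, C.one_mem, ?_⟩
      rw [listPow_cons, listPow_cons, Function.update_self, pow_zero, one_mul, one_mul]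
      congr 1
      exact listPow_congr t fun b hb => by rw [Function.update_of_ne (by rintro rfl; exact hL.1 hb)]
    · obtain ⟨c, hc, e⟩ := ih hL.2 (by simpa [h] using hi)
      obtain ⟨d, hd, e'⟩ := exists_pow_mul_pow_eq hC ht h (k i) (k a)
      refine ⟨d * c, C.mul_mem hd hc, ?_⟩
      calc t i ^ k i * listPow t (a :: L) (Function.update k i 0)
          = t i ^ k i * t a ^ k a * listPow t L (Function.update k i 0) := by
            rw [listPow_cons, Function.update_of_ne (Ne.symm h), mul_assoc]
        _ = d * (t a ^ k a * c) * listPow t L k := by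
            rw [e', mul_assoc, mul_assoc, e]; simp only [mul_assoc]
        _ = d * c * listPow t (a :: L) k := by
            rw [← ((hC c hc a).pow_right (k a)).eq, listPow_cons]; simp only [mul_assoc]

theorem exists_mul_listPow_of_mem [DecidableEq ι] {i : ι} {L : List ι} (hL : L.Nodup)
    (hi : i ∈ L) (k : ι → ℕ) :
    ∃ c ∈ C, t i * listPow t L k = c * listPow t L (Function.update k i (k i + 1)) := by
  obtain ⟨c, hc, e⟩ := exists_listPow_eq hC ht hL hi k
  obtain ⟨d, hd, e'⟩ := exists_pow_mul_listPow_eq hC ht hL hi (Function.update k i (k i + 1))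
  rw [Function.update_self, Function.update_idem] at e'
  refine ⟨c * d, C.mul_mem hc hd, ?_⟩
  rw [mul_assoc, ← e', e, ← mul_assoc, ← (hC c hc i).eq, pow_succ']
  simp only [mul_assoc]

end ListPow

/-! ### Twisted relations and reduction of the Wold summands. -/

section Twisted

variable {H : Type*} [NormedAddCommGroup H] [InnerProductSpace ℂ H] [CompleteSpace H] {n : ℕ}
  {T : Fin n → H →L[ℂ] H} {U : Fin n → Fin n → H →L[ℂ] H}

theorem IsTwistingFamily.adjoint_eq (h : IsTwistingFamily U) {i j : Fin n} (hij : i ≠ j) :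
    adjoint (U i j) = U j i := by
  rcases lt_or_gt_of_ne hij with hl | hl
  · exact (h.swap i j hl).symm
  · rw [h.swap j i hl, ContinuousLinearMap.adjoint_adjoint]

theorem IsTwistingFamily.adjoint_mul_self (h : IsTwistingFamily U) {i j : Fin n} (hij : i ≠ j) :
    adjoint (U i j) * U i j = 1 := by
  rcases lt_or_gt_of_ne hij with hl | hl
  · exact Unitary.star_mul_self_of_mem (h.mem_unitary i j hl)
  · rw [h.swap j i hl, ContinuousLinearMap.adjoint_adjoint]
    exact Unitary.mul_star_self_of_mem (h.mem_unitary j i hl)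

namespace IsDoublyTwistedNearIsometry

theorem commute_adjoint_unitary (h : IsDoublyTwistedNearIsometry T U) {i j : Fin n} (hij : i < j)
    (k : Fin n) : Commute (T k) (adjoint (U i j)) := by
  have hu := h.twisting.mem_unitary i j hij
  have e : T k * U i j = U i j * T k := h.commute i j k hij
  have e1 : star (U i j) * U i j = 1 := Unitary.star_mul_self_of_mem hu
  have e2 : U i j * star (U i j) = 1 := Unitary.mul_star_self_of_mem hu
  change T k * star (U i j) = star (U i j) * T k
  calc T k * star (U i j) = star (U i j) * (U i j * T k) * star (U i j) := by
        rw [← mul_assoc, e1, one_mul]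
    _ = star (U i j) * T k := by rw [← e, mul_assoc, mul_assoc, e2, mul_one]

theorem commute_unitary (h : IsDoublyTwistedNearIsometry T U) {i j : Fin n} (hij : i ≠ j)
    (k : Fin n) : Commute (T k) (U i j) := by
  rcases lt_or_gt_of_ne hij with hl | hl
  · exact h.commute i j k hl
  · rw [h.twisting.swap j i hl]
    exact h.commute_adjoint_unitary hl k

theorem adjoint_commute_unitary (h : IsDoublyTwistedNearIsometry T U) {i j : Fin n} (hij : i ≠ j)
    (k : Fin n) : Commute (adjoint (T k)) (U i j) := by
  rw [← h.twisting.adjoint_eq hij.symm]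
  exact (h.commute_unitary hij.symm k).star_star

theorem mul_twist (h : IsDoublyTwistedNearIsometry T U) {i j : Fin n} (hij : i ≠ j) :
    T i * T j = U i j * (T j * T i) := by
  rcases lt_or_gt_of_ne hij with hl | hl
  · rw [h.mul_comm_twist i j hl, mul_assoc]
  · rw [h.mul_comm_twist j i hl, mul_assoc, ← mul_assoc, ← h.twisting.adjoint_eq hij.symm,
      h.twisting.adjoint_mul_self hij.symm, one_mul]

theorem adjoint_mul_twist (h : IsDoublyTwistedNearIsometry T U) {i j : Fin n} (hij : i ≠ j) :
    adjoint (T i) * T j = U j i * (T j * adjoint (T i)) := by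
  rcases lt_or_gt_of_ne hij with hl | hl
  · rw [h.adjoint_mul i j hl, mul_assoc, h.twisting.adjoint_eq hij]
  · have e := congrArg star (h.adjoint_mul j i hl)
    simp only [star_mul, ContinuousLinearMap.star_eq_adjoint,
      ContinuousLinearMap.adjoint_adjoint] at e
    rw [e, ← mul_assoc, ← ((h.commute_unitary hij.symm j).mul_left
      (h.adjoint_commute_unitary hij.symm i)).eq, mul_assoc]

theorem reduces_unitary (h : IsDoublyTwistedNearIsometry T U) {i j : Fin n} (hij : i ≠ j)
    (k : Fin n) (c : Option ℕ) : Reduces (woldSubspace (T k) c) (U i j) := by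
  constructor
  · intro x hx
    exact apply_mem_woldSubspace_of_commute (h.commute_unitary hij k).symm
      (h.adjoint_commute_unitary hij k).symm c hx
  · intro x hx
    rw [h.twisting.adjoint_eq hij]
    exact apply_mem_woldSubspace_of_commute (h.commute_unitary hij.symm k).symm
      (h.adjoint_commute_unitary hij.symm k).symm c hx

/-- Both `T j` and its adjoint commute with `T i` and with `(T i)*` up to a twist, so
`apply_mem_woldSubspace` applies to each. -/
theorem reduces_of_ne (h : IsDoublyTwistedNearIsometry T U) {i j : Fin n} (hij : i ≠ j)
    (c : Option ℕ) : Reduces (woldSubspace (T i) c) (T j) := by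
  constructor
  · intro x hx
    exact apply_mem_woldSubspace (h.mul_twist hij.symm) (h.commute_unitary hij.symm i)
      (h.adjoint_commute_unitary hij.symm i) (v := U j i * T j)
      (by rw [h.adjoint_mul_twist hij, mul_assoc]) c hx
  · intro x hx
    refine apply_mem_woldSubspace (h.adjoint_mul_twist hij.symm) (h.commute_unitary hij i)
      (h.adjoint_commute_unitary hij i) (v := adjoint (T j) * U i j) ?_ c hx
    have e := congrArg star (h.mul_twist hij.symm)
    simp only [star_mul, ContinuousLinearMap.star_eq_adjoint] at e
    rw [e, h.twisting.adjoint_eq hij.symm, mul_assoc, mul_assoc,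
      (h.adjoint_commute_unitary hij i).eq]

theorem reduces_none (h : IsDoublyTwistedNearIsometry T U) (i j : Fin n) :
    Reduces (woldSubspace (T i) none) (T j) := by
  by_cases hij : i = j
  · subst hij
    exact (h.nearIsometry i).reduces_woldSubspace_none
  · exact h.reduces_of_ne hij none

theorem reduces_listPow (h : IsDoublyTwistedNearIsometry T U) {i : Fin n} {L : List (Fin n)}
    {k : Fin n → ℕ} (hi : i ∈ L → k i = 0) (c : Option ℕ) :
    Reduces (woldSubspace (T i) c) (listPow T L k) := by
  refine Reduces.list_prod fun S hS => ?_
  obtain ⟨a, ha, rfl⟩ := List.mem_map.1 hS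
  by_cases hia : i = a
  · subst hia
    rw [hi ha, pow_zero]
    exact Reduces.one _
  · exact (h.reduces_of_ne hia c).pow _

theorem reduces_none_listPow (h : IsDoublyTwistedNearIsometry T U) (i : Fin n) (L : List (Fin n))
    (k : Fin n → ℕ) : Reduces (woldSubspace (T i) none) (listPow T L k) := by
  refine Reduces.list_prod fun S hS => ?_
  obtain ⟨a, -, rfl⟩ := List.mem_map.1 hS
  exact (h.reduces_none i a).pow _

theorem mem_of_pow_apply_mem (h : IsDoublyTwistedNearIsometry T U) {i j : Fin n} (hij : i ≠ j)
    {c : Option ℕ} {k : ℕ} {x : H} (hx : (T j ^ k) x ∈ woldSubspace (T i) c) :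
    x ∈ woldSubspace (T i) c := by
  have := (h.nearIsometry i).hasOrthogonalProjection c
  exact ((h.reduces_of_ne hij c).pow k).mem_of_apply_mem ((h.nearIsometry j).injective_pow k) hx

end IsDoublyTwistedNearIsometry

/-- The monoid generated by the off-diagonal entries of `U`. -/
def twistMonoid {M : Type*} [Monoid M] (U : Fin n → Fin n → M) : Submonoid M :=
  Submonoid.closure {c | ∃ i j, i ≠ j ∧ c = U i j}

namespace IsDoublyTwistedNearIsometry

theorem twistMonoid_commute (h : IsDoublyTwistedNearIsometry T U) :
    ∀ c ∈ twistMonoid U, ∀ i, Commute c (T i) := by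
  intro c hc i
  induction hc using Submonoid.closure_induction with
  | mem c hc =>
    obtain ⟨p, q, hpq, rfl⟩ := hc
    exact (h.commute_unitary hpq i).symm
  | one => exact Commute.one_left _
  | mul c d _ _ hc hd => exact hc.mul_left hd

theorem exists_twist (h : IsDoublyTwistedNearIsometry T U) :
    ∀ i j, i ≠ j → ∃ c ∈ twistMonoid U, T i * T j = c * (T j * T i) := fun i j hij =>
  ⟨U i j, Submonoid.subset_closure ⟨i, j, hij, rfl⟩, h.mul_twist hij⟩

theorem reduces_twist (h : IsDoublyTwistedNearIsometry T U) {c : H →L[ℂ] H}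
    (hc : c ∈ twistMonoid U) (k : Fin n) (s : Option ℕ) : Reduces (woldSubspace (T k) s) c := by
  induction hc using Submonoid.closure_induction with
  | mem c hc =>
    obtain ⟨p, q, hpq, rfl⟩ := hc
    exact h.reduces_unitary hpq k s
  | one => exact Reduces.one _
  | mul c d _ _ hc hd => exact hc.mul hd

theorem listPow_apply_mem (h : IsDoublyTwistedNearIsometry T U) {i : Fin n} {L : List (Fin n)}
    (hL : L.Nodup) (hi : i ∈ L) (k : Fin n → ℕ) {x : H} (hx : x ∈ woldSubspace (T i) (some 0)) :
    listPow T L k x ∈ woldSubspace (T i) (some (k i)) := by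
  obtain ⟨c, hc, e⟩ := exists_listPow_eq h.twistMonoid_commute h.exists_twist hL hi k
  rw [e]
  refine (h.reduces_twist hc i _).1 _ (mem_woldSubspace_some.2 ⟨_, ?_, rfl⟩)
  exact mem_woldSubspace_zero.1 ((h.reduces_listPow (fun _ => by simp) _).1 x hx)

/-! ### Joint Wold decomposition. -/

theorem exists_listPow_of_mem_iInf (h : IsDoublyTwistedNearIsometry T U) {κ : Fin n → Option ℕ}
    (l : Fin n → ℕ) {L : List (Fin n)} (hL : ∀ i ∈ L, κ i = none) {x : H}
    (hx : ∀ i, x ∈ woldSubspace (T i) (κ i)) :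
    ∃ y, (∀ i, y ∈ woldSubspace (T i) (κ i)) ∧ listPow T L l y = x := by
  induction L generalizing x with
  | nil => exact ⟨x, hx, rfl⟩
  | cons a L ih =>
    have hxa := hx a
    rw [hL a (by simp)] at hxa
    obtain ⟨z, hz, rfl⟩ := (h.nearIsometry a).exists_mem_woldSubspace_none hxa (l a)
    obtain ⟨y, hy, rfl⟩ := ih (x := z) (fun i hi => hL i (by simp [hi])) fun i => by
      by_cases hia : i = a
      · subst hia
        rwa [hL i (by simp)]
      · exact h.mem_of_pow_apply_mem hia (hx i)
    exact ⟨y, hy, by rw [listPow_cons]; rfl⟩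

/-- Peeling off `T a ^ k a` resets the index at `a` to 0, and `mem_of_pow_apply_mem` keeps the other
indices. Thus a joint summand is reached from a wandering subspace. -/
theorem exists_listPow_eq_of_mem (h : IsDoublyTwistedNearIsometry T U) {L : List (Fin n)}
    (hL : L.Nodup) {k : Fin n → ℕ} {κ : Fin n → Option ℕ} (hκ : ∀ i ∈ L, κ i = some (k i)) {x : H}
    (hx : ∀ i, x ∈ woldSubspace (T i) (κ i)) :
    ∃ y, (∀ i, y ∈ woldSubspace (T i) (if i ∈ L then some 0 else κ i)) ∧ listPow T L k y = x := by
  induction L generalizing x κ with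
  | nil => exact ⟨x, by simpa using hx, rfl⟩
  | cons a L ih =>
    rw [List.nodup_cons] at hL
    have hxa := hx a
    rw [hκ a (by simp)] at hxa
    obtain ⟨z, hz, rfl⟩ := mem_woldSubspace_some.1 hxa
    obtain ⟨y, hy, rfl⟩ := ih (x := z) (κ := Function.update κ a (some 0)) hL.2
      (fun i hi => by
        rw [Function.update_of_ne (by rintro rfl; exact hL.1 hi)]
        exact hκ i (by simp [hi])) fun i => by
      by_cases hia : i = a
      · subst hia
        rw [Function.update_self]
        exact mem_woldSubspace_zero.2 hz
      · rw [Function.update_of_ne hia]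
        exact h.mem_of_pow_apply_mem hia (hx i)
    refine ⟨y, fun i => ?_, by rw [listPow_cons]; rfl⟩
    have := hy i
    by_cases hia : i = a
    · subst hia
      simpa [hL.1] using this
    · simpa [hia] using this

theorem starProjection_mem (h : IsDoublyTwistedNearIsometry T U) {i j : Fin n} (hij : i ≠ j)
    (c d : Option ℕ) [(woldSubspace (T i) c).HasOrthogonalProjection] {x : H}
    (hx : x ∈ woldSubspace (T j) d) :
    (woldSubspace (T i) c).starProjection x ∈ woldSubspace (T j) d :=
  apply_mem_woldSubspace_of_commute (h.reduces_of_ne hij c).commute_starProjection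
    (h.reduces_of_ne hij c).adjoint.commute_starProjection d hx

/-- Totality of the joint summands, adding one coordinate `i` at a time. Let `p` be the component of
`x` in a joint summand `N` over `s`. Projecting `p` onto a Wold summand of `T i` stays in `N`, so
the result is orthogonal to `x` and hence 0. As this holds for every summand of `T i`, `p = 0`. -/
theorem eq_zero_of_inner_of_mem (h : IsDoublyTwistedNearIsometry T U) (s : Finset (Fin n)) {x : H}
    (hx : ∀ κ : Fin n → Option ℕ, ∀ y, (∀ i ∈ s, y ∈ woldSubspace (T i) (κ i)) → inner ℂ y x = 0) :
    x = 0 := by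
  induction s using Finset.induction_on with
  | empty => exact inner_self_eq_zero.1 (hx (fun _ => none) x (by simp))
  | insert i s hi ih =>
    refine ih fun κ => ?_
    let N : Submodule ℂ H := ⨅ j ∈ s, woldSubspace (T j) (κ j)
    have hmem : ∀ y, y ∈ N ↔ ∀ j ∈ s, y ∈ woldSubspace (T j) (κ j) := by simp [N]
    have hN : IsClosed (N : Set H) := by
      simp only [N, Submodule.coe_iInf]
      exact isClosed_iInter fun j => isClosed_iInter fun _ =>
        (h.nearIsometry j).isClosed_woldSubspace _
    have := hN.completeSpace_coe
    obtain ⟨p, hp, q, hq, rfl⟩ := N.exists_add_mem_mem_orthogonal x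
    have hp0 : p = 0 := by
      refine (h.nearIsometry i).eq_zero_of_inner_woldSubspace fun c y hy => ?_
      have := (h.nearIsometry i).hasOrthogonalProjection c
      set P := (woldSubspace (T i) c).starProjection with hP
      have hPN : P p ∈ N := (hmem _).2 fun j hj =>
        h.starProjection_mem (by rintro rfl; exact hi hj) _ _ ((hmem p).1 hp j hj)
      have hPi : P p ∈ woldSubspace (T i) c := Submodule.starProjection_apply_mem _ _
      have h0 : inner ℂ (P p) (p + q) = 0 := by
        refine hx (Function.update κ i c) _ fun j hj => ?_
        by_cases hji : j = i
        · subst hji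
          rwa [Function.update_self]
        · rw [Function.update_of_ne hji]
          exact (hmem _).1 hPN j (by simpa [hji] using hj)
      rw [inner_add_right, hq _ hPN, add_zero] at h0
      have hPp : P p = 0 := by
        rw [← inner_self_eq_zero (𝕜 := ℂ)]
        have := Submodule.starProjection_inner_eq_zero (K := woldSubspace (T i) c) p (P p) hPi
        rw [← hP, inner_sub_left, inner_eq_zero_symm.1 h0, zero_sub, neg_eq_zero] at this
        exact this
      exact (Submodule.starProjection_apply_eq_zero_iff _).1 hPp y hy
    intro y hy
    rw [hp0, zero_add]
    exact hq y ((hmem y).2 hy)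

end IsDoublyTwistedNearIsometry

/-! ### Wandering subspaces as joint Wold summands. -/

/-- The Wold indices of the vectors in the `A`-wandering subspace. -/
def wanderingIndex (A : Finset (Fin n)) (i : Fin n) : Option ℕ := if i ∈ A then some 0 else none

/-- The increasing list of the elements of `A`. -/
def indexList (A : Finset (Fin n)) : List (Fin n) := (List.finRange n).filter (fun a => a ∈ A)

theorem mem_indexList {A : Finset (Fin n)} {i : Fin n} : i ∈ indexList A ↔ i ∈ A := by
  simp [indexList]

theorem nodup_indexList (A : Finset (Fin n)) : (indexList A).Nodup :=
  (List.nodup_finRange n).filter _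

theorem tuplePow_eq_listPow {H : Type*} [NormedAddCommGroup H] [InnerProductSpace ℂ H] (T : Fin n → H →L[ℂ] H) (A : Finset (Fin n)) (k : Fin n → ℕ) :
    tuplePow T A k = listPow T (indexList A) k := rfl

theorem mem_kerSubspace {A : Finset (Fin n)} {x : H} :
    x ∈ kerSubspace T A ↔ ∀ i ∈ A, adjoint (T i) x = 0 := by
  simp [kerSubspace]

theorem mem_wanderingSubspace {A : Finset (Fin n)} {x : H} :
    x ∈ wanderingSubspace T A ↔
      ∀ l, ∃ y, (∀ i ∈ A, adjoint (T i) y = 0) ∧ tuplePow T Aᶜ l y = x := by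
  simp only [wanderingSubspace, Submodule.mem_iInf, Submodule.mem_map, mem_kerSubspace]
  rfl

namespace IsDoublyTwistedNearIsometry

/-- The wandering subspace consists of the vectors that lie in `ker Tᵢ*` for `i ∈ A` and in the
range of every power of `Tᵢ` for `i ∉ A`. -/
theorem mem_wanderingSubspace_iff (h : IsDoublyTwistedNearIsometry T U) {A : Finset (Fin n)}
    {x : H} :
    x ∈ wanderingSubspace T A ↔ ∀ i, x ∈ woldSubspace (T i) (wanderingIndex A i) := by
  rw [mem_wanderingSubspace]
  constructor
  · intro hx i
    by_cases hi : i ∈ A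
    · obtain ⟨y, hy, rfl⟩ := hx 0
      rw [wanderingIndex, if_pos hi, mem_woldSubspace_zero]
      have : tuplePow T Aᶜ 0 = 1 := by simp [tuplePow]
      rw [this]
      exact hy i hi
    · rw [wanderingIndex, if_neg hi, mem_woldSubspace_none]
      intro m
      -- Any multi-index with entry `m` at `i` would do; `T i ^ m` is then brought to the front of
      -- the product.
      obtain ⟨y, hy, rfl⟩ := hx (fun _ => m)
      obtain ⟨c, hc, e⟩ := exists_listPow_eq h.twistMonoid_commute h.exists_twist
        (nodup_indexList Aᶜ) (mem_indexList.2 (Finset.mem_compl.2 hi)) (fun _ => m)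
      rw [tuplePow_eq_listPow, e, ← mul_assoc, ((h.twistMonoid_commute c hc i).pow_right m).eq,
        mul_assoc]
      exact ⟨_, rfl⟩
  · intro hx l
    obtain ⟨y, hy, rfl⟩ := h.exists_listPow_of_mem_iInf (κ := wanderingIndex A) l
      (L := indexList Aᶜ)
      (fun i hi => if_neg (Finset.mem_compl.1 (mem_indexList.1 hi))) hx
    refine ⟨y, fun i hi => ?_, rfl⟩
    have := hy i
    rwa [wanderingIndex, if_pos hi, mem_woldSubspace_zero] at this

theorem unitary_mem_wanderingSubspace (h : IsDoublyTwistedNearIsometry T U) {A : Finset (Fin n)}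
    {x : H} (hx : x ∈ wanderingSubspace T A) {i j : Fin n} (hij : i ≠ j) :
    U i j x ∈ wanderingSubspace T A := by
  rw [h.mem_wanderingSubspace_iff] at hx ⊢
  exact fun k => (h.reduces_unitary hij k _).1 x (hx k)

theorem apply_mem_wanderingSubspace (h : IsDoublyTwistedNearIsometry T U) {A : Finset (Fin n)}
    {x : H} (hx : x ∈ wanderingSubspace T A) {j : Fin n} (hj : j ∉ A) :
    T j x ∈ wanderingSubspace T A := by
  rw [h.mem_wanderingSubspace_iff] at hx ⊢
  intro i
  by_cases hij : i = j
  · subst hij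
    have := hx i
    rw [wanderingIndex, if_neg hj] at this ⊢
    exact (h.reduces_none i i).1 x this
  · exact (h.reduces_of_ne hij _).1 x (hx i)

theorem tuplePow_apply_mem (h : IsDoublyTwistedNearIsometry T U) {A : Finset (Fin n)}
    (k : Fin n → ℕ) {x : H} (hx : x ∈ wanderingSubspace T A) (i : Fin n) :
    tuplePow T A k x ∈ woldSubspace (T i) (if i ∈ A then some (k i) else none) := by
  rw [h.mem_wanderingSubspace_iff] at hx
  have hxi := hx i
  by_cases hi : i ∈ A
  · rw [wanderingIndex, if_pos hi] at hxi
    rw [if_pos hi]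
    exact h.listPow_apply_mem (nodup_indexList A) (mem_indexList.2 hi) k hxi
  · rw [wanderingIndex, if_neg hi] at hxi
    rw [if_neg hi]
    exact (h.reduces_none_listPow i _ k).1 x hxi

theorem adjoint_mul_self_mem_wanderingSubspace (h : IsDoublyTwistedNearIsometry T U)
    {A : Finset (Fin n)} (k : Fin n → ℕ) {x : H} (hx : x ∈ wanderingSubspace T A) :
    (adjoint (tuplePow T A k) * tuplePow T A k) x ∈ wanderingSubspace T A := by
  rw [h.mem_wanderingSubspace_iff]
  intro i
  have hxi := h.tuplePow_apply_mem k hx i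
  by_cases hi : i ∈ A
  · rw [if_pos hi] at hxi
    rw [wanderingIndex, if_pos hi, mem_woldSubspace_zero]
    rw [← mem_woldSubspace_zero, mul_apply_eq_comp]
    obtain ⟨c, hc, e⟩ := exists_listPow_eq h.twistMonoid_commute h.exists_twist
      (nodup_indexList A) (mem_indexList.2 hi) k
    rw [tuplePow_eq_listPow] at hxi ⊢
    set u := listPow T (indexList A) k x
    -- The adjoint acts in three stages: the twist preserves the summand of index `k i`, then the
    -- adjoint of `T i ^ k i` lowers the index to 0, and the remaining factors, free of `T i`,
    -- preserve `ker (T i)*`.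
    rw [e, ← ContinuousLinearMap.star_eq_adjoint, star_mul, star_mul]
    refine (h.reduces_listPow (fun _ => by simp) _).2 _ ?_
    exact (h.nearIsometry i).adjoint_pow_apply_mem ((h.reduces_twist hc i _).2 u hxi)
  · rw [if_neg hi] at hxi
    rw [wanderingIndex, if_neg hi]
    exact (h.reduces_none_listPow i _ k).2 _ hxi

theorem inner_tuplePow_eq_zero (h : IsDoublyTwistedNearIsometry T U) {A B : Finset (Fin n)}
    {k l : Fin n → ℕ} {x y : H} (hx : x ∈ wanderingSubspace T A) (hy : y ∈ wanderingSubspace T B)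
    {i : Fin n} (hi : (if i ∈ A then some (k i) else none) ≠ if i ∈ B then some (l i) else none) :
    inner ℂ (tuplePow T A k x) (tuplePow T B l y) = 0 :=
  (h.nearIsometry i).inner_woldSubspace hi (h.tuplePow_apply_mem k hx i)
    (h.tuplePow_apply_mem l hy i)

theorem eq_zero_of_inner_tuplePow (h : IsDoublyTwistedNearIsometry T U) {x : H}
    (hx : ∀ A k, ∀ y ∈ wanderingSubspace T A, inner ℂ (tuplePow T A k y) x = 0) : x = 0 := by
  refine h.eq_zero_of_inner_of_mem Finset.univ fun κ y hy => ?_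
  -- The finite entries of `κ` give both `A` and the exponents; the default exponent 0 occurs only
  -- outside `A`, where it has no effect.
  let A : Finset (Fin n) := Finset.univ.filter fun i => (κ i).isSome
  obtain ⟨z, hz, rfl⟩ := h.exists_listPow_eq_of_mem (nodup_indexList A)
    (k := fun i => (κ i).getD 0) (κ := κ) (fun i hi => by
      have : (κ i).isSome := by simpa [A] using mem_indexList.1 hi
      obtain ⟨m, hm⟩ := Option.isSome_iff_exists.1 this
      simp [hm]) (fun i => hy i (Finset.mem_univ i))
  refine hx A _ z (h.mem_wanderingSubspace_iff.2 fun i => ?_)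
  have := hz i
  simp only [mem_indexList] at this
  by_cases hi : i ∈ A
  · rwa [wanderingIndex, if_pos hi, ← if_pos (c := i ∈ A) (t := some 0) (e := κ i) hi]
  · rw [if_neg hi] at this
    have hn : κ i = none := by simpa [A] using hi
    rwa [wanderingIndex, if_neg hi, ← hn]

end IsDoublyTwistedNearIsometry

end Twisted

/-! ### Unitary equivalence and wandering data. -/

section Equivalence

variable {H K : Type*} [NormedAddCommGroup H] [InnerProductSpace ℂ H]
  [NormedAddCommGroup K] [InnerProductSpace ℂ K] {n : ℕ}

theorem apply_pow_of_intertwines {X : H →L[ℂ] H} {Y : K →L[ℂ] K} (V : H ≃ₗᵢ[ℂ] K)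
    (h : ∀ x, V (X x) = Y (V x)) (k : ℕ) (x : H) : V ((X ^ k) x) = (Y ^ k) (V x) := by
  induction k generalizing x with
  | zero => rfl
  | succ k ih => simp only [pow_succ, mul_apply_eq_comp, ih, h]

theorem apply_listPow_of_intertwines {ι : Type*} {T : ι → H →L[ℂ] H} {S : ι → K →L[ℂ] K}
    (V : H ≃ₗᵢ[ℂ] K) (h : ∀ i x, V (T i x) = S i (V x)) (L : List ι) (k : ι → ℕ) (x : H) :
    V (listPow T L k x) = listPow S L k (V x) := by
  induction L generalizing x with
  | nil => rfl
  | cons a L ih =>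
    simp only [listPow_cons, mul_apply_eq_comp, apply_pow_of_intertwines V (h a), ih]

/-- Reordering in the product monoid treats both tuples at once, so that the same word of twists
appears on both sides. -/
theorem listPow_prodMk {ι : Type*} (T : ι → H →L[ℂ] H) (T' : ι → K →L[ℂ] K) (L : List ι)
    (k : ι → ℕ) :
    listPow (fun i => (T i, T' i)) L k = (listPow T L k, listPow T' L k) :=
  Prod.ext (map_listPow (MonoidHom.fst _ _) (fun i => (T i, T' i)) L k)
    (map_listPow (MonoidHom.snd _ _) (fun i => (T i, T' i)) L k)

theorem IntertwinesOn.mul {D : Submodule ℂ H} {E : Submodule ℂ K} {V : D ≃ₗᵢ[ℂ] E}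
    {X₁ X₂ : H →L[ℂ] H} {Y₁ Y₂ : K →L[ℂ] K} (h₁ : IntertwinesOn V X₁ Y₁)
    (h₂ : IntertwinesOn V X₂ Y₂) : IntertwinesOn V (X₁ * X₂) (Y₁ * Y₂) := by
  intro x
  obtain ⟨hx, e⟩ := h₂ x
  obtain ⟨hx', e'⟩ := h₁ ⟨X₂ x, hx⟩
  exact ⟨hx', e'.trans (congrArg Y₁ e)⟩

theorem apply_adjoint_of_intertwines [CompleteSpace H] [CompleteSpace K] {X : H →L[ℂ] H}
    {Y : K →L[ℂ] K} (V : H ≃ₗᵢ[ℂ] K) (h : ∀ x, V (X x) = Y (V x)) (x : H) :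
    V (adjoint X x) = adjoint Y (V x) := by
  refine ext_inner_right ℂ fun y => ?_
  obtain ⟨z, rfl⟩ := V.surjective y
  rw [ContinuousLinearMap.adjoint_inner_left, ← h, V.inner_map_map, V.inner_map_map,
    ContinuousLinearMap.adjoint_inner_left]

variable [CompleteSpace H] [CompleteSpace K]
  {T : Fin n → H →L[ℂ] H} {U : Fin n → Fin n → H →L[ℂ] H}
  {T' : Fin n → K →L[ℂ] K} {U' : Fin n → Fin n → K →L[ℂ] K}

theorem apply_mem_wanderingSubspace_of_intertwines (V : H ≃ₗᵢ[ℂ] K)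
    (h : ∀ i x, V (T i x) = T' i (V x)) {A : Finset (Fin n)} {x : H}
    (hx : x ∈ wanderingSubspace T A) : V x ∈ wanderingSubspace T' A := by
  rw [mem_wanderingSubspace] at hx ⊢
  intro l
  obtain ⟨y, hy, rfl⟩ := hx l
  refine ⟨V y, fun i hi => ?_, (apply_listPow_of_intertwines V h _ l y).symm⟩
  rw [← apply_adjoint_of_intertwines V (h i), hy i hi, map_zero]

theorem mem_wanderingSubspace_iff_of_intertwines (V : H ≃ₗᵢ[ℂ] K)
    (h : ∀ i x, V (T i x) = T' i (V x)) (A : Finset (Fin n)) (x : H) :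
    x ∈ wanderingSubspace T A ↔ V x ∈ wanderingSubspace T' A := by
  refine ⟨apply_mem_wanderingSubspace_of_intertwines V h, fun hx => ?_⟩
  have := apply_mem_wanderingSubspace_of_intertwines V.symm (T := T') (T' := T)
    (fun i y => by rw [LinearIsometryEquiv.symm_apply_eq, h, V.apply_symm_apply]) hx
  rwa [V.symm_apply_apply] at this

/-- The twisting unitaries are determined by the tuple. -/
theorem IsDoublyTwistedNearIsometry.apply_unitary_of_intertwines
    (h : IsDoublyTwistedNearIsometry T U) (h' : IsDoublyTwistedNearIsometry T' U')
    (V : H ≃ₗᵢ[ℂ] K) (hV : ∀ i x, V (T i x) = T' i (V x)) {i j : Fin n} (hij : i ≠ j) (x : H) :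
    V (U i j x) = U' i j (V x) := by
  -- Since `U i j` commutes with the tuple, `T j T i U i j = T i T j`, and likewise for the primed
  -- tuple; the injective factors cancel.
  refine (h'.nearIsometry i).injective ((h'.nearIsometry j).injective ?_)
  have e := DFunLike.congr_fun (h.mul_twist hij) x
  have e' := DFunLike.congr_fun (h'.mul_twist hij) (V x)
  have c1 := DFunLike.congr_fun (h.commute_unitary hij j).eq (T i x)
  have c2 := DFunLike.congr_fun (h.commute_unitary hij i).eq x
  have c1' := DFunLike.congr_fun (h'.commute_unitary hij j).eq (T' i (V x))
  have c2' := DFunLike.congr_fun (h'.commute_unitary hij i).eq (V x)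
  simp only [mul_apply_eq_comp] at e e' c1 c2 c1' c2'
  rw [← hV, ← hV, c2, c1, ← e, c2', c1', ← e', hV, hV]

theorem IsDoublyTwistedNearIsometry.exists_wandering_equiv
    (h : IsDoublyTwistedNearIsometry T U) (h' : IsDoublyTwistedNearIsometry T' U')
    (V : H ≃ₗᵢ[ℂ] K) (hV : ∀ i x, V (T i x) = T' i (V x)) (A : Finset (Fin n)) :
    ∃ W : wanderingSubspace T A ≃ₗᵢ[ℂ] wanderingSubspace T' A,
      (∀ k : Fin n → ℕ, IntertwinesOn W (adjoint (tuplePow T A k) * tuplePow T A k)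
        (adjoint (tuplePow T' A k) * tuplePow T' A k)) ∧
      (∀ j, j ∉ A → IntertwinesOn W (T j) (T' j)) ∧
      (∀ i j, i ≠ j → IntertwinesOn W (U i j) (U' i j)) := by
  obtain ⟨W, hW⟩ := V.exists_restrict (mem_wanderingSubspace_iff_of_intertwines V hV A)
  have hk : ∀ k x, V (tuplePow T A k x) = tuplePow T' A k (V x) :=
    apply_listPow_of_intertwines V hV _
  refine ⟨W, fun k x => ⟨h.adjoint_mul_self_mem_wanderingSubspace k x.2, ?_⟩,
    fun j hj x => ⟨h.apply_mem_wanderingSubspace x.2 hj, ?_⟩,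
    fun i j hij x => ⟨h.unitary_mem_wanderingSubspace x.2 hij, ?_⟩⟩
  · rw [hW, hW]
    change V (adjoint (tuplePow T A k) (tuplePow T A k x)) =
      adjoint (tuplePow T' A k) (tuplePow T' A k (V x))
    rw [apply_adjoint_of_intertwines V (hk k), hk]
  · rw [hW, hW, hV]
  · rw [hW, hW, h.apply_unitary_of_intertwines h' V hV hij]

theorem intertwinesOn_twistMonoid {H K : Type*} [NormedAddCommGroup H] [InnerProductSpace ℂ H]
    [NormedAddCommGroup K] [InnerProductSpace ℂ K] {U : Fin n → Fin n → H →L[ℂ] H}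
    {U' : Fin n → Fin n → K →L[ℂ] K} {D : Submodule ℂ H} {E : Submodule ℂ K} {V : D ≃ₗᵢ[ℂ] E}
    (hV : ∀ i j, i ≠ j → IntertwinesOn V (U i j) (U' i j)) {c : (H →L[ℂ] H) × (K →L[ℂ] K)}
    (hc : c ∈ twistMonoid fun i j => (U i j, U' i j)) : IntertwinesOn V c.1 c.2 := by
  induction hc using Submonoid.closure_induction with
  | mem c hc =>
    obtain ⟨p, q, hpq, rfl⟩ := hc
    exact hV p q hpq
  | one => exact fun x => ⟨x.2, rfl⟩
  | mul c d _ _ hc hd => exact hc.mul hd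

/-- Applying `Tᵢ` and `Tᵢ'` to corresponding vectors `T_A^k x` and `T'_A^k (V x)` gives
corresponding vectors. -/
theorem IsDoublyTwistedNearIsometry.exists_apply_tuplePow (h : IsDoublyTwistedNearIsometry T U)
    (h' : IsDoublyTwistedNearIsometry T' U') {A : Finset (Fin n)}
    {V : wanderingSubspace T A ≃ₗᵢ[ℂ] wanderingSubspace T' A}
    (hT : ∀ j, j ∉ A → IntertwinesOn V (T j) (T' j))
    (hU : ∀ i j, i ≠ j → IntertwinesOn V (U i j) (U' i j)) (k : Fin n → ℕ) (i : Fin n)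
    (x : wanderingSubspace T A) :
    ∃ (l : Fin n → ℕ) (y : wanderingSubspace T A), T i (tuplePow T A k x) = tuplePow T A l y ∧
      T' i (tuplePow T' A k (V x)) = tuplePow T' A l (V y) := by
  set C := twistMonoid fun i j => (U i j, U' i j)
  have hC : ∀ c ∈ C, ∀ i, Commute c (T i, T' i) := by
    intro c hc i
    induction hc using Submonoid.closure_induction with
    | mem c hc =>
      obtain ⟨p, q, hpq, rfl⟩ := hc
      exact Prod.ext (h.commute_unitary hpq i).eq.symm (h'.commute_unitary hpq i).eq.symm
    | one => exact Commute.one_left _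
    | mul c d _ _ hc hd => exact hc.mul_left hd
  have ht : ∀ i j, i ≠ j → ∃ c ∈ C, (T i, T' i) * (T j, T' j) = c * ((T j, T' j) * (T i, T' i)) :=
    fun i j hij => ⟨(U i j, U' i j), Submonoid.subset_closure ⟨i, j, hij, rfl⟩,
      Prod.ext (h.mul_twist hij) (h'.mul_twist hij)⟩
  have hcomm : ∀ c ∈ C, ∀ l, Commute c (listPow (fun i => (T i, T' i)) (indexList A) l) := by
    intro c hc l
    refine Commute.list_prod_right _ _ fun S hS => ?_
    obtain ⟨a, -, rfl⟩ := List.mem_map.1 hS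
    exact (hC c hc a).pow_right _
  by_cases hi : i ∈ A
  · obtain ⟨c, hc, e⟩ := exists_mul_listPow_of_mem hC ht (nodup_indexList A)
      (mem_indexList.2 hi) k
    -- The twist is moved to the right of the product so that it acts on `x`, inside the wandering
    -- subspace, where `V` is defined and intertwines it.
    rw [(hcomm c hc _).eq, listPow_prodMk, listPow_prodMk] at e
    obtain ⟨hy, hVy⟩ := intertwinesOn_twistMonoid hU hc x
    refine ⟨Function.update k i (k i + 1), ⟨c.1 x, hy⟩,
      DFunLike.congr_fun (congrArg Prod.fst e) (x : H), ?_⟩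
    rw [hVy]
    exact DFunLike.congr_fun (congrArg Prod.snd e) (V x : K)
  · obtain ⟨c, hc, e⟩ := exists_mul_listPow_of_notMem hC ht (mt mem_indexList.1 hi) k
    rw [← mul_assoc, (hcomm c hc _).eq, listPow_prodMk, mul_assoc] at e
    obtain ⟨hy, hVy⟩ := (intertwinesOn_twistMonoid hU hc).mul (hT i hi) x
    refine ⟨k, ⟨(c.1 * T i) x, hy⟩, DFunLike.congr_fun (congrArg Prod.fst e) (x : H), ?_⟩
    rw [hVy]
    exact DFunLike.congr_fun (congrArg Prod.snd e) (V x : K)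

theorem IsDoublyTwistedNearIsometry.tupleUnitarilyEquivalent
    (h : IsDoublyTwistedNearIsometry T U) (h' : IsDoublyTwistedNearIsometry T' U')
    (hV : ∀ A : Finset (Fin n), ∃ V : wanderingSubspace T A ≃ₗᵢ[ℂ] wanderingSubspace T' A,
      (∀ k : Fin n → ℕ, IntertwinesOn V (adjoint (tuplePow T A k) * tuplePow T A k)
        (adjoint (tuplePow T' A k) * tuplePow T' A k)) ∧
      (∀ j, j ∉ A → IntertwinesOn V (T j) (T' j)) ∧
      (∀ i j, i ≠ j → IntertwinesOn V (U i j) (U' i j))) :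
    TupleUnitarilyEquivalent T T' := by
  choose V hG hT hU using hV
  let p : (Σ A : Finset (Fin n), (Fin n → ℕ) × wanderingSubspace T A) → H :=
    fun s => tuplePow T s.1 s.2.1 s.2.2
  let q : (Σ A : Finset (Fin n), (Fin n → ℕ) × wanderingSubspace T A) → K :=
    fun s => tuplePow T' s.1 s.2.1 (V s.1 s.2.2)
  have hp : ∀ x, (∀ s, inner ℂ (p s) x = 0) → x = 0 := fun x hx =>
    h.eq_zero_of_inner_tuplePow fun A k y hy => hx ⟨A, k, y, hy⟩
  have hq : ∀ x, (∀ s, inner ℂ (q s) x = 0) → x = 0 := fun x hx =>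
    h'.eq_zero_of_inner_tuplePow fun A k y hy => by
      have := hx ⟨A, k, (V A).symm ⟨y, hy⟩⟩
      simpa only [q, LinearIsometryEquiv.apply_symm_apply] using this
  have hpq : ∀ s t, inner ℂ (p s) (p t) = inner ℂ (q s) (q t) := by
    rintro ⟨A, k, x⟩ ⟨B, l, y⟩
    -- Equal joint indices force `A = B` and `k = l` on `A`, and the inner product is governed by
    -- the Gram operator; otherwise some coordinate makes both inner products vanish.
    by_cases hc : ∀ i, (if i ∈ A then some (k i) else none) = if i ∈ B then some (l i) else none
    · have hAB : A = B := by
        ext i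
        have := hc i
        split_ifs at this <;> simp_all
      subst hAB
      have hkl : ∀ a ∈ indexList A, l a = k a := fun a ha => by
        have := hc a
        rw [if_pos (mem_indexList.1 ha), if_pos (mem_indexList.1 ha)] at this
        exact (Option.some.inj this).symm
      simp only [p, q]
      rw [tuplePow_eq_listPow T A l, tuplePow_eq_listPow T' A l, listPow_congr T hkl,
        listPow_congr T' hkl, ← tuplePow_eq_listPow, ← tuplePow_eq_listPow,
        ← ContinuousLinearMap.adjoint_inner_left, ← ContinuousLinearMap.adjoint_inner_left,
        ← mul_apply_eq_comp, ← mul_apply_eq_comp]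
      obtain ⟨hx, e⟩ := hG A k x
      rw [← e, ← Submodule.coe_inner, (V A).inner_map_map, Submodule.coe_inner]
    · obtain ⟨i, hi⟩ := not_forall.1 hc
      simp only [p, q]
      rw [h.inner_tuplePow_eq_zero x.2 y.2 hi, h'.inner_tuplePow_eq_zero (V A x).2 (V B y).2 hi]
  obtain ⟨W, hW⟩ := exists_linearIsometryEquiv_of_inner_eq hpq hp hq
  refine ⟨W, fun i y => ?_⟩
  -- By continuity it suffices to compare the two sides on the total family `p`.
  have key : (W : H →L[ℂ] K) ∘L T i = T' i ∘L (W : H →L[ℂ] K) := by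
    refine ContinuousLinearMap.ext_on
      (s := Set.range p) ?_ ?_
    · rw [← Finsupp.range_linearCombination]
      exact denseRange_linearCombination hp
    · rintro _ ⟨⟨A, k, x⟩, rfl⟩
      obtain ⟨l, y, e, e'⟩ := h.exists_apply_tuplePow h' (hT A) (hU A) k i x
      change W (T i (tuplePow T A k x)) = T' i (W (p ⟨A, k, x⟩))
      rw [e, hW]
      exact (hW ⟨A, l, y⟩).trans e'.symm
  have := DFunLike.congr_fun key (W.symm y)
  simpa using this

theorem IsDoublyTwistedNearIsometry.tupleUnitarilyEquivalent_iff
    (h : IsDoublyTwistedNearIsometry T U) (h' : IsDoublyTwistedNearIsometry T' U') :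
    TupleUnitarilyEquivalent T T' ↔
      ∀ A : Finset (Fin n), ∃ V : wanderingSubspace T A ≃ₗᵢ[ℂ] wanderingSubspace T' A,
        (∀ k : Fin n → ℕ, IntertwinesOn V (adjoint (tuplePow T A k) * tuplePow T A k)
          (adjoint (tuplePow T' A k) * tuplePow T' A k)) ∧
        (∀ j, j ∉ A → IntertwinesOn V (T j) (T' j)) ∧
        (∀ i j, i ≠ j → IntertwinesOn V (U i j) (U' i j)) := by
  refine ⟨?_, h.tupleUnitarilyEquivalent h'⟩
  rintro ⟨V, hV⟩
  exact h.exists_wandering_equiv h' V fun i x => by simpa using hV i (V x)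

end Equivalence

/-! ### The case of isometries. -/

section Isometry

variable {H : Type*} [NormedAddCommGroup H] [InnerProductSpace ℂ H] [CompleteSpace H] {n : ℕ}
  {T : Fin n → H →L[ℂ] H} {U : Fin n → Fin n → H →L[ℂ] H}

theorem adjoint_mul_self_of_isometry {S : H →L[ℂ] H} (hS : Isometry S) : adjoint S * S = 1 :=
  S.norm_map_iff_adjoint_comp_self.1 (AddMonoidHomClass.isometry_iff_norm S |>.1 hS)

theorem isNearIsometry_of_isometry {S : H →L[ℂ] H} (hS : Isometry S) : IsNearIsometry S := by
  have hn := (AddMonoidHomClass.isometry_iff_norm S).1 hS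
  refine ⟨⟨1, one_pos, fun x => by rw [one_mul, hn]⟩, fun x => (hn x).le, fun m x => ⟨x, ?_⟩⟩
  have : adjoint S ^ m * S ^ (m + 1) = S := by
    induction m with
    | zero => simp
    | succ m ih =>
      rw [pow_succ, pow_succ' S (m + 1), mul_assoc, ← mul_assoc (adjoint S),
        adjoint_mul_self_of_isometry hS, one_mul, ih]
  exact DFunLike.congr_fun this x

theorem adjoint_listPow_mul_self (hT : ∀ i, Isometry (T i)) (L : List (Fin n)) (k : Fin n → ℕ) :
    adjoint (listPow T L k) * listPow T L k = 1 := by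
  refine adjoint_mul_self_of_isometry ((AddMonoidHomClass.isometry_iff_norm _).2 fun x => ?_)
  have hp : ∀ i m y, ‖(T i ^ m) y‖ = ‖y‖ := by
    intro i m
    induction m with
    | zero => exact fun _ => rfl
    | succ m ih =>
      intro y
      rw [pow_succ, mul_apply_eq_comp, ih, (AddMonoidHomClass.isometry_iff_norm _).1 (hT i)]
  induction L with
  | nil => rfl
  | cons a L ih => rw [listPow_cons, mul_apply_eq_comp, hp, ih]

/-- With `D = T i T j - U i j T j T i`, each of the four products in the expansion of `D* D` equals
1, the mixed ones by the adjoint relation. The signs cancel, so `D* D = 0` and `D = 0`. -/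
theorem IsDoublyTwistedIsometry.mul_comm_twist (h : IsDoublyTwistedIsometry T U) {i j : Fin n}
    (hij : i < j) : T i * T j = U i j * T j * T i := by
  have hu := h.twisting.mem_unitary i j hij
  have u1 : star (U i j) * U i j = 1 := Unitary.star_mul_self_of_mem hu
  have u2 : U i j * star (U i j) = 1 := Unitary.mul_star_self_of_mem hu
  have i1 : star (T i) * T i = 1 := adjoint_mul_self_of_isometry (h.isometry i)
  have j1 : star (T j) * T j = 1 := adjoint_mul_self_of_isometry (h.isometry j)
  have e : star (T i) * T j = star (U i j) * T j * star (T i) := h.adjoint_mul i j hij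
  have ci : T i * U i j = U i j * T i := h.commute i j i hij
  have cj : T j * U i j = U i j * T j := h.commute i j j hij
  have ci' : star (T i) * U i j = U i j * star (T i) := by
    have c : T i * star (U i j) = star (U i j) * T i := by
      calc T i * star (U i j) = star (U i j) * (U i j * T i) * star (U i j) := by
            rw [← mul_assoc, u1, one_mul]
        _ = star (U i j) * T i := by rw [← ci, mul_assoc, mul_assoc, u2, mul_one]
    have := congrArg star c
    simpa only [star_mul, star_star] using this.symm
  -- the mixed term of `‖(T i T j - U T j T i) x‖²`
  have m : star (T j) * star (T i) * (U i j * T j * T i) = 1 := by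
    calc star (T j) * star (T i) * (U i j * T j * T i)
        = star (T j) * (star (T i) * U i j) * T j * T i := by simp only [mul_assoc]
      _ = star (T j) * U i j * (star (T i) * T j) * T i := by rw [ci']; simp only [mul_assoc]
      _ = star (T j) * (U i j * star (U i j)) * T j * (star (T i) * T i) := by
          rw [e]; simp only [mul_assoc]
      _ = 1 := by rw [u2, mul_one, i1, mul_one, j1]
  have m' : star (T i) * star (T j) * star (U i j) * (T i * T j) = 1 := by
    have := congrArg star m
    simpa only [star_mul, star_star, star_one, mul_assoc] using this
  have a : star (T j) * star (T i) * (T i * T j) = 1 := by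
    rw [mul_assoc, ← mul_assoc (star (T i)), i1, one_mul, j1]
  have b : star (T i) * star (T j) * star (U i j) * (U i j * T j * T i) = 1 := by
    calc star (T i) * star (T j) * star (U i j) * (U i j * T j * T i)
        = star (T i) * (star (T j) * ((star (U i j) * U i j) * T j)) * T i := by
          simp only [mul_assoc]
      _ = 1 := by rw [u1, one_mul, j1, mul_one, i1]
  have z : star (T i * T j - U i j * T j * T i) * (T i * T j - U i j * T j * T i) = 0 := by
    rw [star_sub, sub_mul, mul_sub, mul_sub]
    simp only [star_mul, ← mul_assoc] at *
    rw [a, b, m, m']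
    simp
  exact sub_eq_zero.1 ((CStarRing.star_mul_self_eq_zero_iff _).1 z)

theorem IsDoublyTwistedIsometry.isDoublyTwistedNearIsometry (h : IsDoublyTwistedIsometry T U) :
    IsDoublyTwistedNearIsometry T U :=
  ⟨h.twisting, fun i => isNearIsometry_of_isometry (h.isometry i), h.adjoint_mul, h.commute,
    fun _ _ hij => h.mul_comm_twist hij⟩

end Isometry

theorem theorem1 {H K : Type*} [NormedAddCommGroup H] [InnerProductSpace ℂ H] [CompleteSpace H]
    [NormedAddCommGroup K] [InnerProductSpace ℂ K] [CompleteSpace K] {n : ℕ}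
    (T : Fin n → H →L[ℂ] H) (U : Fin n → Fin n → H →L[ℂ] H)
    (T' : Fin n → K →L[ℂ] K) (U' : Fin n → Fin n → K →L[ℂ] K) :
    -- the operators below leave the wandering subspaces invariant
    (IsDoublyTwistedNearIsometry T U → ∀ A : Finset (Fin n), ∀ x ∈ wanderingSubspace T A,
      (∀ k : Fin n → ℕ,
        (adjoint (tuplePow T A k) * tuplePow T A k) x ∈ wanderingSubspace T A) ∧
      (∀ j, j ∉ A → T j x ∈ wanderingSubspace T A) ∧
      (∀ i j, i ≠ j → U i j x ∈ wanderingSubspace T A)) ∧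
    -- the classification of doubly twisted near-isometries
    (IsDoublyTwistedNearIsometry T U → IsDoublyTwistedNearIsometry T' U' →
      (TupleUnitarilyEquivalent T T' ↔
        ∀ A : Finset (Fin n), ∃ V : wanderingSubspace T A ≃ₗᵢ[ℂ] wanderingSubspace T' A,
          (∀ k : Fin n → ℕ,
            IntertwinesOn V (adjoint (tuplePow T A k) * tuplePow T A k)
              (adjoint (tuplePow T' A k) * tuplePow T' A k)) ∧
          (∀ j, j ∉ A → IntertwinesOn V (T j) (T' j)) ∧
          (∀ i j, i ≠ j → IntertwinesOn V (U i j) (U' i j)))) ∧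
    -- the special case of doubly twisted isometries
    (IsDoublyTwistedIsometry T U → IsDoublyTwistedIsometry T' U' →
      IsDoublyTwistedNearIsometry T U ∧ IsDoublyTwistedNearIsometry T' U' ∧
      (TupleUnitarilyEquivalent T T' ↔
        ∀ A : Finset (Fin n), WanderingDataEquivalent T U T' U' A)) := by
  refine ⟨fun h A x hx => ⟨fun k => h.adjoint_mul_self_mem_wanderingSubspace k hx,
    fun j hj => h.apply_mem_wanderingSubspace hx hj,
    fun i j hij => h.unitary_mem_wanderingSubspace hx hij⟩,
    fun h h' => h.tupleUnitarilyEquivalent_iff h', fun h h' => ?_⟩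
  have hn := h.isDoublyTwistedNearIsometry
  have hn' := h'.isDoublyTwistedNearIsometry
  refine ⟨hn, hn', (hn.tupleUnitarilyEquivalent_iff hn').trans (forall_congr' fun A => ?_)⟩
  -- Condition 1 holds automatically, both Gram operators being the identity.
  refine exists_congr fun V => and_iff_right fun k => ?_
  rw [tuplePow_eq_listPow, tuplePow_eq_listPow, adjoint_listPow_mul_self h.isometry,
    adjoint_listPow_mul_self h'.isometry]
  exact fun x => ⟨x.2, rfl⟩
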